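/- Let $\Gamma$ and $\gamma$ be circles in the Euclidean plane with radii $R > r > 0$ whose centres lie at distance $d > 0$, where $d^2 = (R-r)^2 - 4\tan^2(\pi/4)\,Rr = (R-r)^2 - 4Rr$ (so that $\gamma$ lies inside $\Gamma$). Let $a = 1/r$ and $A = -1/R$ be their signed curvatures. A *poristic Steiner 4-chain* is a sequence of four distinct circles $\delta_1,\dots,\delta_4$ of positive radii $r_1,\dots,r_4$, each internally tangent to $\Gamma$ and externally tangent to $\gamma$, such that circles with adjacent indices mod $4$ are externally tangent. The *axis* is the line through the centres of $\Gamma$ and $\gamma$, and a chain is *symmetric* if the reflection in the axis maps the collection of its circles to itself. A poristic chain is *axial* if it contains a circle of the largest and a circle of the smallest radius among all circles of all poristic Steiner 4-chains. It is *lateral* if it is symmetric and its circles have exactly two common points with the axis, every circle that passes through such a point being tangent to the axis there. Let $L = r_1+r_2+r_3+r_4$. Then, over the set of poristic Steiner 4-chains, $L$ attains the maximum $$L^* = -\frac{(A-a)^2}{Aa(a+A)}$$ and the minimum $$L_* = \frac{16(A+a)}{(A-a)^2}.$$ The maximum is attained exactly at the axial chains, and the minimum exactly at the lateral chains. Moreover,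 with respect to the topology given by the centres and radii of the circles, a poristic chain is a local maximum of $L$ if and only if it is axial, a local minimum if and only if it is lateral, and a local extremum if and only if it is symmetric. Up to the labelling of the circles, there are exactly one axial and exactly one lateral chain. -/

import Mathlib

open EuclideanGeometry

/-- The Euclidean plane. -/
abbrev Plane : Type := EuclideanSpace ℝ (Fin 2)

/-- The circle of centre `center` and radius `radius` in the plane. -/
abbrev Circle2 : Type := Sphere Plane

/-- Circles are topologized by their centre and radius: two circles are close when their centres
are close and their radii are close. -/
instance circle2TopologicalSpace : TopologicalSpace Circle2 :=
  TopologicalSpace.induced (fun s : Circle2 => (s.center, s.radius)) inferInstance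

/-- `c 0, c 1, c 2, c 3` is a Steiner chain of four circles with the parent circles `Γ` (outer) and
`γ` (inner): four distinct genuine circles, each internally tangent to `Γ` and externally tangent
to `γ`, such that circles with adjacent indices mod `4` are externally tangent. (Addition in
`Fin 4` is modulo `4`.) -/
structure IsSteinerChain4 (Γ γ : Circle2) (c : Fin 4 → Circle2) : Prop where
  radius_pos : ∀ i, 0 < (c i).radius
  distinct : Function.Injective c
  outer : ∀ i, (c i).IsIntTangent Γ
  inner : ∀ i, (c i).IsExtTangent γ
  adjacent : ∀ i, (c i).IsExtTangent (c (i + 1))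

/-- The poristic Steiner 4-chains: all Steiner 4-chains with the parent circles `Γ` and `γ`. -/
def poristicChains (Γ γ : Circle2) : Set (Fin 4 → Circle2) :=
  {c | IsSteinerChain4 Γ γ c}

/-- The sum `L` of the radii of the circles of a chain. -/
noncomputable def sumRadii (c : Fin 4 → Circle2) : ℝ :=
  ∑ i, (c i).radius

/-- The axis of the porism: the line through the centres of the two parent circles. -/
noncomputable def porismAxis (Γ γ : Circle2) : AffineSubspace ℝ Plane :=
  affineSpan ℝ {Γ.center, γ.center}

/-- The reflection of the plane in the axis of the porism. -/
noncomputable def axisReflection (Γ γ : Circle2) : Plane ≃ᵃⁱ[ℝ] Plane :=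
  reflection (affineSpan ℝ {Γ.center, γ.center})

/-- The chain, as a collection of circles, is symmetric with respect to the axis of the porism:
the mirror image of every circle of the chain is a circle of the chain. -/
def IsAxiSymmetric (Γ γ : Circle2) (c : Fin 4 → Circle2) : Prop :=
  ∀ i, ∃ j, (c j).center = axisReflection Γ γ (c i).center ∧ (c j).radius = (c i).radius

/-- The axial chain: the poristic chain that contains a circle of the biggest radius
and a circle of the smallest radius among all circles of all poristic chains. -/
def IsAxialChain (Γ γ : Circle2) (c : Fin 4 → Circle2) : Prop :=
  c ∈ poristicChains Γ γ ∧
  (∃ i, ∀ c' ∈ poristicChains Γ γ, ∀ j, (c' j).radius ≤ (c i).radius) ∧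
  (∃ i, ∀ c' ∈ poristicChains Γ γ, ∀ j, (c i).radius ≤ (c' j).radius)

/-- A lateral chain: an axisymmetric poristic chain having exactly two common points with the axis
of the porism, where the circles through these points are tangent to the axis. -/
def IsLateralChain (Γ γ : Circle2) (c : Fin 4 → Circle2) : Prop :=
  c ∈ poristicChains Γ γ ∧
  IsAxiSymmetric Γ γ c ∧
  {p : Plane | p ∈ porismAxis Γ γ ∧ ∃ i, p ∈ c i}.ncard = 2 ∧
  ∀ i, ∀ p ∈ c i, p ∈ porismAxis Γ γ → (c i).IsTangentAt p (porismAxis Γ γ)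

/-! With the origin at the centre of `γ` and the first axis towards the centre of `Γ`, the circles
tangent to both parents are parametrized by the unit circle. The curvature of the circle at `(s, t)`
is `(R - r + d * s) / (2 * R * r)`, and its centre lies at signed height `√2 * t` times its radius
above the axis. The gauge condition makes two such circles tangent exactly when their parameters are
orthogonal (`isExtTangent_porismCircle_iff`), so a chain is an orbit of the quarter turn
(`exists_eq_porismChain`).

Opposite circles have constant curvature sum, which makes `L` an explicit, strictly decreasing
function of `(s * t) ^ 2` (`sumRadii_porismChain`). On the unit circle this quantity runs over `[0,
1/4]`. It vanishes exactly at the axial chains and equals `1/4`, that is `s ^ 2 = t ^ 2`, exactly at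
the lateral ones. Its derivative under rotation is `2 * s * t * (s ^ 2 - t ^ 2)`, and reflection in
the axis is `t ↦ -t`, so critical chains and symmetric chains coincide. -/

/-! ### Coordinates along the axis -/

/-- An orthonormal frame `e, f` of the plane adapted to two circles `Γ` and `γ` whose radii and
distance of centres admit a porism of Steiner chains of four circles: `e` points from the centre
of `γ` to the centre of `Γ`. -/
structure PorismFrame (Γ γ : Circle2) (R r d : ℝ) (e f : Plane) : Prop where
  r_pos : 0 < r
  r_lt : r < R
  d_pos : 0 < d
  gauge : d ^ 2 = (R - r) ^ 2 - 4 * R * r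
  radius_outer : Γ.radius = R
  radius_inner : γ.radius = r
  center_outer : Γ.center = γ.center + d • e
  inner_ee : inner ℝ e e = 1
  inner_ff : inner ℝ f f = 1
  inner_ef : inner ℝ e f = 0
  span : ∀ v : Plane, v = inner ℝ e v • e + inner ℝ f v • f

theorem exists_porismFrame {Γ γ : Circle2} {R r d : ℝ}
    (hR : Γ.radius = R) (hr : γ.radius = r) (hd : dist Γ.center γ.center = d)
    (hr0 : 0 < r) (hrR : r < R) (hd0 : 0 < d) (hgauge : d ^ 2 = (R - r) ^ 2 - 4 * R * r) :
    ∃ e f, PorismFrame Γ γ R r d e f := by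
  set w : Plane := Γ.center - γ.center with hw
  have hn : w 0 ^ 2 + w 1 ^ 2 = d ^ 2 := by
    rw [← hd, dist_eq_norm, EuclideanSpace.real_norm_sq_eq, Fin.sum_univ_two]
  have hn' : (w 0 / d) ^ 2 + (w 1 / d) ^ 2 = 1 := by
    field_simp
    exact hn
  refine ⟨!₂[w 0 / d, w 1 / d], !₂[-(w 1 / d), w 0 / d], hr0, hrR, hd0, hgauge, hR, hr,
    ?_, ?_, ?_, ?_, ?_⟩
  · rw [← sub_eq_iff_eq_add', ← hw]
    ext i
    fin_cases i <;> simp <;> field_simp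
  · simp only [PiLp.inner_apply, Fin.sum_univ_two]
    simp [div_pow, sq_abs]
    linear_combination hn'
  · simp only [PiLp.inner_apply, Fin.sum_univ_two]
    simp [div_pow, sq_abs]
    linear_combination hn'
  · simp [PiLp.inner_apply, Fin.sum_univ_two]
    ring
  · intro v
    ext i
    fin_cases i
    · simp [PiLp.inner_apply, Fin.sum_univ_two]
      linear_combination -v 0 * hn'
    · simp [PiLp.inner_apply, Fin.sum_univ_two]
      linear_combination -v 1 * hn'

namespace PorismFrame

variable {Γ γ : Circle2} {R r d : ℝ} {e f : Plane}

theorem dist_eq_iff (h : PorismFrame Γ γ R r d e f) (O : Plane) (x y x' y' k : ℝ) :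
    dist (O + x • e + y • f) (O + x' • e + y' • f) = k ↔
      (x - x') ^ 2 + (y - y') ^ 2 = k ^ 2 ∧ 0 ≤ k := by
  have hsub : (O + x • e + y • f) - (O + x' • e + y' • f) = (x - x') • e + (y - y') • f := by
    module
  have hfe : inner ℝ f e = 0 := by rw [real_inner_comm, h.inner_ef]
  have key : dist (O + x • e + y • f) (O + x' • e + y' • f) ^ 2
      = (x - x') ^ 2 + (y - y') ^ 2 := by
    rw [dist_eq_norm, hsub, ← real_inner_self_eq_norm_sq]
    simp only [inner_add_left, inner_add_right, real_inner_smul_left, real_inner_smul_right,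
      h.inner_ee, h.inner_ff, h.inner_ef, hfe]
    ring
  constructor
  · rintro rfl
    exact ⟨key.symm, dist_nonneg⟩
  · rintro ⟨h1, h2⟩
    exact (sq_eq_sq₀ dist_nonneg h2).1 (key.trans h1)

theorem coord_inj (h : PorismFrame Γ γ R r d e f) {O : Plane} {x y x' y' : ℝ}
    (heq : O + x • e + y • f = O + x' • e + y' • f) : x = x' ∧ y = y' := by
  have h0 := (h.dist_eq_iff O x y x' y' 0).1 (by rw [heq, dist_self])
  constructor <;> nlinarith [sq_nonneg (x - x'), sq_nonneg (y - y')]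

theorem exists_coord (h : PorismFrame Γ γ R r d e f) (O p : Plane) :
    ∃ x y : ℝ, p = O + x • e + y • f :=
  ⟨inner ℝ e (p - O), inner ℝ f (p - O), by
    rw [add_assoc, ← h.span (p - O)]; abel⟩

/-- The gauge gives `d < R - r`, while `|s| ≤ 1`. This is the curvature up to the factor `2 * R *
r`. -/
theorem curvature_pos (h : PorismFrame Γ γ R r d e f) {s t : ℝ} (hst : s ^ 2 + t ^ 2 = 1) :
    0 < R - r + d * s := by
  have h1 := h.gauge
  have h2 := h.r_pos
  have h3 := h.r_lt
  have h4 := h.d_pos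
  have hRr : 0 < R * r := mul_pos (h2.trans h3) h2
  have hd : d < R - r := by nlinarith
  have hs : -1 ≤ s := by nlinarith [sq_nonneg t]
  nlinarith

end PorismFrame

/-! ### Circles tangent to both parents -/

/-- The circle tangent to both parent circles of a porism of Steiner chains of four circles that
belongs to the point `(s, t)` of the unit circle. -/
noncomputable def porismCircle (γ : Circle2) (R r d : ℝ) (e f : Plane) (s t : ℝ) : Circle2 where
  center := γ.center + (-(r * (d + (3 * R - r) * s) / (R - r + d * s))) • e +
    (√2 * t * (2 * R * r / (R - r + d * s))) • f
  radius := 2 * R * r / (R - r + d * s)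

namespace PorismFrame

variable {Γ γ : Circle2} {R r d : ℝ} {e f : Plane}

theorem radius_pos (h : PorismFrame Γ γ R r d e f) {s t : ℝ} (hst : s ^ 2 + t ^ 2 = 1) :
    0 < (porismCircle γ R r d e f s t).radius := by
  have := h.curvature_pos hst
  have h2 := h.r_pos
  have h3 := h2.trans h.r_lt
  simp only [porismCircle]
  positivity

theorem isExtTangent_iff (h : PorismFrame Γ γ R r d e f) (δ : Circle2) {x y : ℝ}
    (hδ : δ.center = γ.center + x • e + y • f) (hpos : 0 < δ.radius) :
    δ.IsExtTangent γ ↔ x ^ 2 + y ^ 2 = (δ.radius + r) ^ 2 := by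
  have h2 := h.r_pos
  have h0 : γ.center = γ.center + (0 : ℝ) • e + (0 : ℝ) • f := by simp
  rw [Sphere.isExtTangent_iff_dist_center, hδ]
  nth_rewrite 2 [h0]
  rw [h.dist_eq_iff, h.radius_inner, sub_zero, sub_zero]
  exact ⟨fun H => H.1.1, fun H => ⟨⟨H, by positivity⟩, hpos.le, h2.le⟩⟩

theorem isIntTangent_iff (h : PorismFrame Γ γ R r d e f) (δ : Circle2) {x y : ℝ}
    (hδ : δ.center = γ.center + x • e + y • f) (hpos : 0 < δ.radius) :
    δ.IsIntTangent Γ ↔ (x - d) ^ 2 + y ^ 2 = (R - δ.radius) ^ 2 ∧ δ.radius ≤ R := by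
  have h2 := h.r_pos.trans h.r_lt
  have h0 : Γ.center = γ.center + d • e + (0 : ℝ) • f := by simp [h.center_outer]
  rw [Sphere.isIntTangent_iff_dist_center, hδ, h0, h.dist_eq_iff, h.radius_outer, sub_zero]
  exact ⟨fun H => ⟨H.1.1, sub_nonneg.1 H.1.2⟩, fun H => ⟨⟨H.1, sub_nonneg.2 H.2⟩, hpos.le, h2.le⟩⟩

theorem isExtTangent_inner (h : PorismFrame Γ γ R r d e f) {s t : ℝ} (hst : s ^ 2 + t ^ 2 = 1) :
    (porismCircle γ R r d e f s t).IsExtTangent γ := by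
  have hc := h.curvature_pos hst
  have h2 : √2 ^ 2 = 2 := Real.sq_sqrt (by norm_num)
  rw [h.isExtTangent_iff _ rfl (h.radius_pos hst)]
  simp only [porismCircle]
  field_simp
  rw [h2]
  linear_combination 8 * R ^ 2 * r ^ 2 * hst - r ^ 2 * (s ^ 2 - 1) * h.gauge

theorem isIntTangent_outer (h : PorismFrame Γ γ R r d e f) {s t : ℝ} (hst : s ^ 2 + t ^ 2 = 1) :
    (porismCircle γ R r d e f s t).IsIntTangent Γ := by
  have hc := h.curvature_pos hst
  have h2 : √2 ^ 2 = 2 := Real.sq_sqrt (by norm_num)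
  rw [h.isIntTangent_iff _ rfl (h.radius_pos hst)]
  have h3 := h.r_pos
  have h4 := h.r_lt
  have h5 := h.d_pos
  have h1 := h.gauge
  have hRr : 0 < R * r := mul_pos (h3.trans h4) h3
  constructor
  · simp only [porismCircle]
    -- Seen from the centre of `Γ`, the gauge lets a factor `R` be pulled out, and the computation
    -- becomes parallel to the one for `γ`.
    have hx : -(r * (d + (3 * R - r) * s) / (R - r + d * s)) - d =
        -(R * (d + (R - 3 * r) * s) / (R - r + d * s)) := by
      field_simp
      linear_combination -s * h1
    rw [hx]
    field_simp
    rw [h2]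
    linear_combination 8 * R ^ 2 * r ^ 2 * hst - R ^ 2 * (s ^ 2 - 1) * h1
  · simp only [porismCircle]
    rw [div_le_iff₀ hc]
    have hs : -1 ≤ s := by nlinarith [sq_nonneg t]
    -- The gauge reads `d ^ 2 = (R - 3 * r) ^ 2 - 8 * r ^ 2`, and the radius is at most `R` once `2
    -- * r ≤ R - r - d`.
    have hM : 0 < R - 3 * r := by nlinarith
    have : d < R - 3 * r := by nlinarith
    nlinarith [h3.trans h4]

/-- Both circles touch `γ`, so the law of cosines turns tangency into a condition on the inner
product of the centres. After clearing the curvatures, the gauge reduces it to a nonzero multiple of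
`s * s' + t * t'`. -/
theorem isExtTangent_porismCircle_iff (h : PorismFrame Γ γ R r d e f) {s t s' t' : ℝ}
    (hst : s ^ 2 + t ^ 2 = 1) (hst' : s' ^ 2 + t' ^ 2 = 1) :
    (porismCircle γ R r d e f s t).IsExtTangent (porismCircle γ R r d e f s' t') ↔
      s * s' + t * t' = 0 := by
  have hc := h.curvature_pos hst
  have hc' := h.curvature_pos hst'
  have hp := h.radius_pos hst
  have hp' := h.radius_pos hst'
  have h2 : √2 ^ 2 = 2 := Real.sq_sqrt (by norm_num)
  have e1 := (h.isExtTangent_iff _ rfl hp).1 (h.isExtTangent_inner hst)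
  have e2 := (h.isExtTangent_iff _ rfl hp').1 (h.isExtTangent_inner hst')
  have h3 := h.r_pos
  have h4 := h3.trans h.r_lt
  have key : ∀ x y x' y' ρ ρ' : ℝ, x ^ 2 + y ^ 2 = (ρ + r) ^ 2 → x' ^ 2 + y' ^ 2 = (ρ' + r) ^ 2 →
      ((x - x') ^ 2 + (y - y') ^ 2 = (ρ + ρ') ^ 2 ↔
        x * x' + y * y' = (r + ρ) * (r + ρ') - 2 * ρ * ρ') := by
    intro x y x' y' ρ ρ' h1 h2
    constructor <;> intro h <;> linarith
  rw [Sphere.isExtTangent_iff_dist_center]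
  have : dist (porismCircle γ R r d e f s t).center (porismCircle γ R r d e f s' t').center =
      (porismCircle γ R r d e f s t).radius + (porismCircle γ R r d e f s' t').radius ↔
      s * s' + t * t' = 0 := by
    refine (h.dist_eq_iff _ _ _ _ _ _).trans ?_
    rw [key _ _ _ _ _ _ e1 e2, and_iff_left (add_pos hp hp').le]
    simp only [porismCircle]
    field_simp
    rw [h2, ← sub_eq_zero]
    have hne : 8 * R ^ 2 ≠ 0 := by positivity
    rw [← mul_right_inj' hne (b := s * s' + t * t'), mul_zero]
    refine Eq.congr ?_ rfl
    linear_combination -(s * s' - 1) * h.gauge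
  rw [this]
  exact and_iff_left ⟨hp.le, hp'.le⟩

end PorismFrame

namespace PorismFrame

variable {Γ γ : Circle2} {R r d : ℝ} {e f : Plane}

theorem exists_eq_porismCircle (h : PorismFrame Γ γ R r d e f) {δ : Circle2}
    (hpos : 0 < δ.radius) (hin : δ.IsExtTangent γ) (hout : δ.IsIntTangent Γ) :
    ∃ s t : ℝ, s ^ 2 + t ^ 2 = 1 ∧ δ = porismCircle γ R r d e f s t := by
  obtain ⟨x, y, hc⟩ := h.exists_coord γ.center δ.center
  have h1 := (h.isExtTangent_iff δ hc hpos).1 hin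
  have h2 := ((h.isIntTangent_iff δ hc hpos).1 hout).1
  have hd := h.d_pos
  have hr := h.r_pos
  have hR := hr.trans h.r_lt
  have hq : √2 ^ 2 = 2 := Real.sq_sqrt (by norm_num)
  have hq0 : √2 ≠ 0 := by positivity
  set ρ := δ.radius with hρ
  -- The difference of the two tangency equations is linear in `x`: the radius determines `x`, and
  -- `y` up to sign.
  have hx : d * x = r * (r - 3 * R) + ρ * (r + R) := by
    linear_combination (h1 - h2 + h.gauge) / 2
  have hy : d ^ 2 * y ^ 2 = d ^ 2 * (ρ + r) ^ 2 - (r * (r - 3 * R) + ρ * (r + R)) ^ 2 := by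
    rw [← hx]
    linear_combination d ^ 2 * h1
  have hden : R - r + d * ((2 * R * r / ρ - (R - r)) / d) = 2 * R * r / ρ := by
    field_simp
    ring
  have hrad : 2 * R * r / (2 * R * r / ρ) = ρ := by
    field_simp
  -- These values solve the radius and height formulas of `porismCircle` for `s` and `t`.
  refine ⟨(2 * R * r / ρ - (R - r)) / d, y / (√2 * ρ), ?_, ?_⟩
  · field_simp
    rw [hq]
    linear_combination hy + (- ρ ^ 2 + r ^ 2 + 2 * ρ * r) * h.gauge
  · apply EuclideanGeometry.Sphere.ext
    · simp only [porismCircle]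
      rw [hden, hrad, hc]
      congr 3
      · field_simp
        linear_combination 2 * R * hx + ρ * h.gauge
      · field_simp
    · simp only [porismCircle]
      rw [hden, hrad]

theorem porismCircle_inj (h : PorismFrame Γ γ R r d e f) {s t s' t' : ℝ}
    (hst : s ^ 2 + t ^ 2 = 1) (hst' : s' ^ 2 + t' ^ 2 = 1) :
    porismCircle γ R r d e f s t = porismCircle γ R r d e f s' t' ↔ s = s' ∧ t = t' := by
  refine ⟨fun H => ?_, fun H => by rw [H.1, H.2]⟩
  have hc := h.curvature_pos hst
  have hc' := h.curvature_pos hst'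
  have hd := h.d_pos
  have hr := h.r_pos
  have hR := hr.trans h.r_lt
  have h1 : 2 * R * r / (R - r + d * s) = 2 * R * r / (R - r + d * s') :=
    congrArg Sphere.radius H
  have hs : s = s' := by
    rw [div_eq_div_iff hc.ne' hc'.ne'] at h1
    have h2 := mul_left_cancel₀ (by positivity) h1
    have h3 : d * s = d * s' := by linarith
    exact mul_left_cancel₀ hd.ne' h3
  have h2 := (h.coord_inj (congrArg Sphere.center H)).2
  subst hs
  refine ⟨rfl, ?_⟩
  have h3 := mul_right_cancel₀ (by positivity) h2
  exact mul_left_cancel₀ (by positivity) h3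

end PorismFrame

/-! ### Chains as orbits of a quarter turn -/

/-- The Steiner chain of four circles whose first circle belongs to the point `(s, t)` of the unit
circle; `ε = ±1` is its orientation. -/
noncomputable def porismChain (γ : Circle2) (R r d : ℝ) (e f : Plane) (ε s t : ℝ) :
    Fin 4 → Circle2 :=
  ![porismCircle γ R r d e f s t, porismCircle γ R r d e f (-(ε * t)) (ε * s),
    porismCircle γ R r d e f (-s) (-t), porismCircle γ R r d e f (ε * t) (-(ε * s))]

theorem eq_or_eq_of_orthogonal {s t u v : ℝ} (hst : s ^ 2 + t ^ 2 = 1) (huv : u ^ 2 + v ^ 2 = 1)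
    (h : s * u + t * v = 0) : ∃ ε : ℝ, ε ^ 2 = 1 ∧ u = -(ε * t) ∧ v = ε * s := by
  -- The determinant of the two unit vectors; its square is `1` by Lagrange's identity.
  refine ⟨s * v - t * u, ?_, ?_, ?_⟩
  · linear_combination (u ^ 2 + v ^ 2) * hst + huv - (s * u + t * v) * h
  · linear_combination -u * hst + s * h
  · linear_combination -v * hst + t * h

namespace PorismFrame

variable {Γ γ : Circle2} {R r d : ℝ} {e f : Plane}

theorem porismChain_mem (h : PorismFrame Γ γ R r d e f) {ε s t : ℝ} (hε : ε ^ 2 = 1)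
    (hst : s ^ 2 + t ^ 2 = 1) : porismChain γ R r d e f ε s t ∈ poristicChains Γ γ := by
  have hst1 : (-(ε * t)) ^ 2 + (ε * s) ^ 2 = 1 := by linear_combination ε ^ 2 * hst + hε
  have hst2 : (-s) ^ 2 + (-t) ^ 2 = 1 := by linear_combination hst
  have hst3 : (ε * t) ^ 2 + (-(ε * s)) ^ 2 = 1 := by linear_combination ε ^ 2 * hst + hε
  constructor
  · intro i
    fin_cases i
    exacts [h.radius_pos hst, h.radius_pos hst1, h.radius_pos hst2, h.radius_pos hst3]
  · have n1 : ¬ (s = -(ε * t) ∧ t = ε * s) := by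
      rintro ⟨h1, h2⟩
      nlinarith
    have n2 : ¬ (s = -s ∧ t = -t) := by
      rintro ⟨h1, h2⟩
      nlinarith
    have n3 : ¬ (s = ε * t ∧ t = -(ε * s)) := by
      rintro ⟨h1, h2⟩
      nlinarith
    have n4 : ¬ (-(ε * t) = -s ∧ ε * s = -t) := by
      rintro ⟨h1, h2⟩
      exact n3 ⟨by linarith, by linarith⟩
    have n5 : ¬ (-(ε * t) = ε * t ∧ ε * s = -(ε * s)) := by
      rintro ⟨h1, h2⟩
      nlinarith
    have n6 : ¬ (-s = ε * t ∧ -t = -(ε * s)) := by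
      rintro ⟨h1, h2⟩
      exact n1 ⟨by linarith, by linarith⟩
    rw [← h.porismCircle_inj hst hst1] at n1
    rw [← h.porismCircle_inj hst hst2] at n2
    rw [← h.porismCircle_inj hst hst3] at n3
    rw [← h.porismCircle_inj hst1 hst2] at n4
    rw [← h.porismCircle_inj hst1 hst3] at n5
    rw [← h.porismCircle_inj hst2 hst3] at n6
    intro i j hij
    fin_cases i <;> fin_cases j
    exacts [rfl, (n1 hij).elim, (n2 hij).elim, (n3 hij).elim, (n1 hij.symm).elim, rfl,
      (n4 hij).elim, (n5 hij).elim, (n2 hij.symm).elim, (n4 hij.symm).elim, rfl,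
      (n6 hij).elim, (n3 hij.symm).elim, (n5 hij.symm).elim, (n6 hij.symm).elim, rfl]
  · intro i
    fin_cases i
    exacts [h.isIntTangent_outer hst, h.isIntTangent_outer hst1, h.isIntTangent_outer hst2,
      h.isIntTangent_outer hst3]
  · intro i
    fin_cases i
    exacts [h.isExtTangent_inner hst, h.isExtTangent_inner hst1, h.isExtTangent_inner hst2,
      h.isExtTangent_inner hst3]
  · intro i
    fin_cases i
    exacts [(h.isExtTangent_porismCircle_iff hst hst1).2 (by ring),
      (h.isExtTangent_porismCircle_iff hst1 hst2).2 (by ring),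
      (h.isExtTangent_porismCircle_iff hst2 hst3).2 (by ring),
      (h.isExtTangent_porismCircle_iff hst3 hst).2 (by ring)]

/-- Consecutive parameters differ by a quarter turn in one of two directions. A change of direction
would repeat a circle, so distinctness forces a single orientation. -/
theorem exists_eq_porismChain (h : PorismFrame Γ γ R r d e f) {c : Fin 4 → Circle2}
    (hc : c ∈ poristicChains Γ γ) :
    ∃ ε s t : ℝ, ε ^ 2 = 1 ∧ s ^ 2 + t ^ 2 = 1 ∧ c = porismChain γ R r d e f ε s t := by
  have hex : ∀ i, ∃ s t : ℝ, s ^ 2 + t ^ 2 = 1 ∧ c i = porismCircle γ R r d e f s t :=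
    fun i => h.exists_eq_porismCircle (hc.radius_pos i) (hc.inner i) (hc.outer i)
  choose s t hst hci using hex
  have hadj : ∀ i, s i * s (i + 1) + t i * t (i + 1) = 0 := fun i => by
    have := hc.adjacent i
    rwa [hci i, hci (i + 1), h.isExtTangent_porismCircle_iff (hst i) (hst (i + 1))] at this
  have hne : ∀ i j, i ≠ j → ¬ (s i = s j ∧ t i = t j) := fun i j hij H =>
    hij (hc.distinct (by rw [hci i, hci j, H.1, H.2]))
  obtain ⟨ε, hε, h1, h1'⟩ := eq_or_eq_of_orthogonal (hst 0) (hst 1) (hadj 0)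
  obtain ⟨η, hη, h2, h2'⟩ := eq_or_eq_of_orthogonal (hst 1) (hst 2) (hadj 1)
  obtain ⟨ζ, hζ, h3, h3'⟩ := eq_or_eq_of_orthogonal (hst 2) (hst 3) (hadj 2)
  have e2 : η = ε := by
    rcases sq_eq_sq_iff_eq_or_eq_neg.1 (hη.trans hε.symm) with H | H
    · exact H
    · refine (hne 2 0 (by decide) ⟨?_, ?_⟩).elim
      · rw [h2, h1', H]; linear_combination s 0 * hε
      · rw [h2', h1, H]; linear_combination t 0 * hε
  subst e2
  have k2 : s 2 = -s 0 := by rw [h2, h1']; linear_combination -s 0 * hε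
  have k2' : t 2 = -t 0 := by rw [h2', h1]; linear_combination -t 0 * hε
  have e3 : ζ = η := by
    rcases sq_eq_sq_iff_eq_or_eq_neg.1 (hζ.trans hε.symm) with H | H
    · exact H
    · refine (hne 3 1 (by decide) ⟨?_, ?_⟩).elim
      · rw [h3, k2', h1, H]; ring
      · rw [h3', k2, h1', H]; ring
  subst e3
  refine ⟨ζ, s 0, t 0, hε, hst 0, ?_⟩
  funext i
  rw [hci i]
  fin_cases i
  · rfl
  · simp [porismChain, h1, h1']
  · simp [porismChain, k2, k2']
  · simp [porismChain, h3, h3', k2, k2']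

end PorismFrame

/-! ### The sum of radii and the axial chains -/

namespace PorismFrame

variable {Γ γ : Circle2} {R r d : ℝ} {e f : Plane}

/-- The equation says that the doubled angles of `(u, v)` and `(s, t)` agree modulo `π`, so the
points differ by a multiple of a quarter turn. It describes the chain as a set, free of order and
orientation. -/
theorem porismCircle_mem_range_iff (h : PorismFrame Γ γ R r d e f) {ε s t u v : ℝ}
    (hε : ε ^ 2 = 1) (hst : s ^ 2 + t ^ 2 = 1) (huv : u ^ 2 + v ^ 2 = 1) :
    porismCircle γ R r d e f u v ∈ Set.range (porismChain γ R r d e f ε s t) ↔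
      (s ^ 2 - t ^ 2) * (u * v) = s * t * (u ^ 2 - v ^ 2) := by
  have hst1 : (-(ε * t)) ^ 2 + (ε * s) ^ 2 = 1 := by linear_combination ε ^ 2 * hst + hε
  have hst2 : (-s) ^ 2 + (-t) ^ 2 = 1 := by linear_combination hst
  have hst3 : (ε * t) ^ 2 + (-(ε * s)) ^ 2 = 1 := by linear_combination ε ^ 2 * hst + hε
  constructor
  · rintro ⟨i, hi⟩
    have aux : ∀ {u' v' : ℝ}, u' ^ 2 + v' ^ 2 = 1 →
        porismCircle γ R r d e f u' v' = porismCircle γ R r d e f u v →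
        (s ^ 2 - t ^ 2) * (u' * v') = s * t * (u' ^ 2 - v' ^ 2) →
        (s ^ 2 - t ^ 2) * (u * v) = s * t * (u ^ 2 - v ^ 2) := by
      intro u' v' h1 h2 h3
      obtain ⟨rfl, rfl⟩ := (h.porismCircle_inj h1 huv).1 h2
      exact h3
    fin_cases i
    exacts [aux hst hi (by ring), aux hst1 hi (by ring), aux hst2 hi (by ring),
      aux hst3 hi (by ring)]
  · intro H
    have H' : (s * u + t * v) * (s * v - t * u) = 0 := by linear_combination H
    rcases mul_eq_zero.1 H' with H1 | H1
    · obtain ⟨η, hη, rfl, rfl⟩ := eq_or_eq_of_orthogonal hst huv H1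
      rcases sq_eq_sq_iff_eq_or_eq_neg.1 (hη.trans hε.symm) with rfl | rfl
      · exact ⟨1, rfl⟩
      · refine ⟨3, ?_⟩
        simp [porismChain]
    · obtain ⟨η, hη, hv, hu⟩ := eq_or_eq_of_orthogonal hst
        (show v ^ 2 + (-u) ^ 2 = 1 by linear_combination huv) (by linear_combination H1)
      have hu' : u = -(η * s) := by linarith
      subst hv hu'
      rcases sq_eq_sq_iff_eq_or_eq_neg.1 (hη.trans (one_pow 2).symm) with rfl | rfl
      · refine ⟨2, ?_⟩
        simp [porismChain]
      · refine ⟨0, ?_⟩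
        simp [porismChain]

theorem porismChain_apply (h : PorismFrame Γ γ R r d e f) {ε s t : ℝ}
    (hε : ε ^ 2 = 1) (hst : s ^ 2 + t ^ 2 = 1) (i : Fin 4) :
    ∃ u v : ℝ, u ^ 2 + v ^ 2 = 1 ∧ (s ^ 2 - t ^ 2) * (u * v) = s * t * (u ^ 2 - v ^ 2) ∧
      porismChain γ R r d e f ε s t i = porismCircle γ R r d e f u v := by
  have hm := h.porismChain_mem hε hst
  obtain ⟨u, v, huv, hi⟩ := h.exists_eq_porismCircle (hm.radius_pos i) (hm.inner i) (hm.outer i)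
  exact ⟨u, v, huv, (h.porismCircle_mem_range_iff hε hst huv).1 ⟨i, hi⟩, hi⟩

/-- In each opposite pair the terms `d * s` (or `d * ε * t`) cancel from the sum of the curvatures,
leaving the same numerator for both pairs. -/
theorem sumRadii_porismChain (h : PorismFrame Γ γ R r d e f) {ε s t : ℝ}
    (hε : ε ^ 2 = 1) (hst : s ^ 2 + t ^ 2 = 1) :
    sumRadii (porismChain γ R r d e f ε s t) =
      4 * R * r * (R - r) * (R + r) ^ 2 / (4 * R * r * (R - r) ^ 2 + d ^ 4 * (s * t) ^ 2) := by
  have hst1 : (-(ε * t)) ^ 2 + (ε * s) ^ 2 = 1 := by linear_combination ε ^ 2 * hst + hε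
  have hst2 : (-s) ^ 2 + (-t) ^ 2 = 1 := by linear_combination hst
  have hst3 : (ε * t) ^ 2 + (-(ε * s)) ^ 2 = 1 := by linear_combination ε ^ 2 * hst + hε
  have h0 := h.curvature_pos hst
  have h1 := h.curvature_pos hst1
  have h2 := h.curvature_pos hst2
  have h3 := h.curvature_pos hst3
  have hr := h.r_pos
  have hR := hr.trans h.r_lt
  have hM := sub_pos.2 h.r_lt
  have hprod : (R - r + d * s) * (R - r + d * -s) * ((R - r + d * (-(ε * t))) * (R - r + d * (ε * t)))
      = 4 * R * r * (R - r) ^ 2 + d ^ 4 * (s * t) ^ 2 := by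
    have e1 : (R - r + d * (-(ε * t))) * (R - r + d * (ε * t)) = (R - r) ^ 2 - d ^ 2 * t ^ 2 := by
      linear_combination -d ^ 2 * t ^ 2 * hε
    rw [e1]
    linear_combination -(R - r) ^ 2 * d ^ 2 * hst - (R - r) ^ 2 * h.gauge
  have e1 : 2 * R * r / (R - r + d * s) + 2 * R * r / (R - r + d * -s) =
      4 * R * r * (R - r) / ((R - r + d * s) * (R - r + d * -s)) := by
    rw [div_add_div _ _ h0.ne' h2.ne']
    ring
  have e2 : 2 * R * r / (R - r + d * (-(ε * t))) + 2 * R * r / (R - r + d * (ε * t)) =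
      4 * R * r * (R - r) / ((R - r + d * (-(ε * t))) * (R - r + d * (ε * t))) := by
    rw [div_add_div _ _ h1.ne' h3.ne']
    ring
  have : sumRadii (porismChain γ R r d e f ε s t) =
      (2 * R * r / (R - r + d * s) + 2 * R * r / (R - r + d * -s)) +
      (2 * R * r / (R - r + d * (-(ε * t))) + 2 * R * r / (R - r + d * (ε * t))) := by
    simp only [sumRadii, Fin.sum_univ_four]
    change 2 * R * r / (R - r + d * s) + 2 * R * r / (R - r + d * (-(ε * t))) +
      2 * R * r / (R - r + d * -s) + 2 * R * r / (R - r + d * (ε * t)) = _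
    ring
  rw [this, e1, e2, div_add_div _ _ (by positivity) (by positivity), hprod]
  congr 1
  linear_combination 4 * R * r * (R - r) * (-d ^ 2 * t ^ 2 * hε - d ^ 2 * hst - h.gauge)

theorem sumRadii_le_iff (h : PorismFrame Γ γ R r d e f) {ε s t ε' s' t' : ℝ}
    (hε : ε ^ 2 = 1) (hst : s ^ 2 + t ^ 2 = 1) (hε' : ε' ^ 2 = 1) (hst' : s' ^ 2 + t' ^ 2 = 1) :
    sumRadii (porismChain γ R r d e f ε s t) ≤ sumRadii (porismChain γ R r d e f ε' s' t') ↔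
      (s' * t') ^ 2 ≤ (s * t) ^ 2 := by
  have hr := h.r_pos
  have hR := hr.trans h.r_lt
  have hM := sub_pos.2 h.r_lt
  have hd := h.d_pos
  rw [h.sumRadii_porismChain hε hst, h.sumRadii_porismChain hε' hst',
    div_le_div_iff_of_pos_left (by positivity) (by positivity) (by positivity),
    add_le_add_iff_left, mul_le_mul_iff_right₀ (by positivity)]

theorem sumRadii_eq_max_iff (h : PorismFrame Γ γ R r d e f) {ε s t : ℝ}
    (hε : ε ^ 2 = 1) (hst : s ^ 2 + t ^ 2 = 1) :
    sumRadii (porismChain γ R r d e f ε s t) = (R + r) ^ 2 / (R - r) ↔ s * t = 0 := by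
  have hr := h.r_pos
  have hR := hr.trans h.r_lt
  have hM := sub_pos.2 h.r_lt
  have hd := h.d_pos
  rw [h.sumRadii_porismChain hε hst, div_eq_div_iff (by positivity) hM.ne', ← sub_eq_zero]
  have : 4 * R * r * (R - r) * (R + r) ^ 2 * (R - r) -
      (R + r) ^ 2 * (4 * R * r * (R - r) ^ 2 + d ^ 4 * (s * t) ^ 2) =
      -((R + r) ^ 2 * d ^ 4) * (s * t) ^ 2 := by ring
  rw [this, mul_eq_zero, neg_eq_zero, or_iff_right (by positivity), sq_eq_zero_iff]

theorem sumRadii_eq_min_iff (h : PorismFrame Γ γ R r d e f) {ε s t : ℝ}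
    (hε : ε ^ 2 = 1) (hst : s ^ 2 + t ^ 2 = 1) :
    sumRadii (porismChain γ R r d e f ε s t) = 16 * R * r * (R - r) / (R + r) ^ 2 ↔
      s ^ 2 = t ^ 2 := by
  have hr := h.r_pos
  have hR := hr.trans h.r_lt
  have hM := sub_pos.2 h.r_lt
  have hd := h.d_pos
  rw [h.sumRadii_porismChain hε hst, div_eq_div_iff (by positivity) (by positivity),
    ← sub_eq_zero]
  have : 4 * R * r * (R - r) * (R + r) ^ 2 * (R + r) ^ 2 -
      16 * R * r * (R - r) * (4 * R * r * (R - r) ^ 2 + d ^ 4 * (s * t) ^ 2) =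
      (4 * R * r * (R - r) * d ^ 4) * (s ^ 2 - t ^ 2) ^ 2 := by
    -- `(R + r) ^ 2` and `d ^ 2` are the sum and the difference of `(R - r) ^ 2` and `4 * R * r`.
    have h4 : (R + r) ^ 4 = 16 * R * r * (R - r) ^ 2 + d ^ 4 := by
      linear_combination (-d ^ 2 - (R - r) ^ 2 + 4 * R * r) * h.gauge
    have h5 : (s ^ 2 - t ^ 2) ^ 2 = 1 - 4 * (s * t) ^ 2 := by
      linear_combination (s ^ 2 + t ^ 2 + 1) * hst
    rw [h5]
    linear_combination 4 * R * r * (R - r) * h4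
  rw [this, mul_eq_zero, or_iff_right (by positivity), sq_eq_zero_iff, sub_eq_zero]

/-- The right-hand side does not depend on `ε`, `s`, `t`, which yields uniqueness up to labelling;
likewise in the lateral case. -/
theorem porismChain_range_axial (h : PorismFrame Γ γ R r d e f) {ε s t : ℝ}
    (hε : ε ^ 2 = 1) (hst : s ^ 2 + t ^ 2 = 1) (h0 : s * t = 0) :
    Set.range (porismChain γ R r d e f ε s t) =
      {q | ∃ u v : ℝ, u ^ 2 + v ^ 2 = 1 ∧ u * v = 0 ∧ q = porismCircle γ R r d e f u v} := by
  have hne : (s ^ 2 - t ^ 2) ^ 2 = 1 := by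
    linear_combination (s ^ 2 + t ^ 2 + 1) * hst - 4 * s * t * h0
  have hne' : s ^ 2 - t ^ 2 ≠ 0 := fun H => by simp [H] at hne
  ext q
  constructor
  · rintro ⟨i, rfl⟩
    obtain ⟨u, v, huv, H, hi⟩ := h.porismChain_apply hε hst i
    refine ⟨u, v, huv, ?_, hi⟩
    rw [h0, zero_mul, mul_eq_zero, or_iff_right hne'] at H
    exact H
  · rintro ⟨u, v, huv, H, rfl⟩
    rw [h.porismCircle_mem_range_iff hε hst huv, H, h0, mul_zero, zero_mul]

theorem porismChain_range_lateral (h : PorismFrame Γ γ R r d e f) {ε s t : ℝ}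
    (hε : ε ^ 2 = 1) (hst : s ^ 2 + t ^ 2 = 1) (h0 : s ^ 2 = t ^ 2) :
    Set.range (porismChain γ R r d e f ε s t) =
      {q | ∃ u v : ℝ, u ^ 2 + v ^ 2 = 1 ∧ u ^ 2 = v ^ 2 ∧ q = porismCircle γ R r d e f u v} := by
  have hne : (2 * (s * t)) ^ 2 = 1 := by
    linear_combination (s ^ 2 + t ^ 2 + 1) * hst - (s ^ 2 - t ^ 2) * h0
  have hne' : s * t ≠ 0 := fun H => by simp [H] at hne
  ext q
  constructor
  · rintro ⟨i, rfl⟩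
    obtain ⟨u, v, huv, H, hi⟩ := h.porismChain_apply hε hst i
    refine ⟨u, v, huv, ?_, hi⟩
    rw [h0, sub_self, zero_mul, eq_comm, mul_eq_zero, or_iff_right hne', sub_eq_zero] at H
    exact H
  · rintro ⟨u, v, huv, H, rfl⟩
    rw [h.porismCircle_mem_range_iff hε hst huv, H, h0, sub_self, sub_self, mul_zero, zero_mul]

theorem radius_le_iff (h : PorismFrame Γ γ R r d e f) {s t s' t' : ℝ}
    (hst : s ^ 2 + t ^ 2 = 1) (hst' : s' ^ 2 + t' ^ 2 = 1) :
    (porismCircle γ R r d e f s t).radius ≤ (porismCircle γ R r d e f s' t').radius ↔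
      s' ≤ s := by
  have hr := h.r_pos
  have hR := hr.trans h.r_lt
  simp only [porismCircle]
  rw [div_le_div_iff_of_pos_left (by positivity) (h.curvature_pos hst) (h.curvature_pos hst'),
    add_le_add_iff_left, mul_le_mul_iff_right₀ h.d_pos]

/-- The radius decreases in `s`, so the extreme circles sit at `(-1, 0)` and `(1, 0)`. These are
opposite, so a chain with one contains the other. -/
theorem isAxialChain_iff (h : PorismFrame Γ γ R r d e f) {ε s t : ℝ}
    (hε : ε ^ 2 = 1) (hst : s ^ 2 + t ^ 2 = 1) :
    IsAxialChain Γ γ (porismChain γ R r d e f ε s t) ↔ s * t = 0 := by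
  have h1 : (-1 : ℝ) ^ 2 + 0 ^ 2 = 1 := by norm_num
  have h2 : (1 : ℝ) ^ 2 + 0 ^ 2 = 1 := by norm_num
  constructor
  · rintro ⟨-, ⟨i, hi⟩, -⟩
    obtain ⟨u, v, huv, H, hc⟩ := h.porismChain_apply hε hst i
    have := hi _ (h.porismChain_mem hε h1) 0
    rw [hc] at this
    have hu : u ≤ -1 := (h.radius_le_iff h1 huv).1 this
    have hv : v = 0 := by nlinarith
    have hu' : u ^ 2 = 1 := by rw [← huv, hv]; ring
    rw [hv, hu'] at H
    linarith
  · intro h0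
    have hrange := h.porismChain_range_axial hε hst h0
    have m1 : porismCircle γ R r d e f (-1) 0 ∈ Set.range (porismChain γ R r d e f ε s t) := by
      rw [hrange]
      exact ⟨_, _, h1, by norm_num, rfl⟩
    have m2 : porismCircle γ R r d e f 1 0 ∈ Set.range (porismChain γ R r d e f ε s t) := by
      rw [hrange]
      exact ⟨_, _, h2, by norm_num, rfl⟩
    obtain ⟨i, hi⟩ := m1
    obtain ⟨j, hj⟩ := m2
    refine ⟨h.porismChain_mem hε hst, ⟨i, fun c' hc' k => ?_⟩, ⟨j, fun c' hc' k => ?_⟩⟩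
    · obtain ⟨u, v, huv, hk⟩ :=
        h.exists_eq_porismCircle (hc'.radius_pos k) (hc'.inner k) (hc'.outer k)
      rw [hi, hk, h.radius_le_iff huv h1]
      nlinarith [sq_nonneg v]
    · obtain ⟨u, v, huv, hk⟩ :=
        h.exists_eq_porismCircle (hc'.radius_pos k) (hc'.inner k) (hc'.outer k)
      rw [hj, hk, h.radius_le_iff h2 huv]
      nlinarith [sq_nonneg v]

end PorismFrame

/-! ### Reflection in the axis and the lateral chains -/

namespace PorismFrame

variable {Γ γ : Circle2} {R r d : ℝ} {e f : Plane}

theorem mem_porismAxis_iff (h : PorismFrame Γ γ R r d e f) (p : Plane) :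
    p ∈ porismAxis Γ γ ↔ ∃ x : ℝ, p = γ.center + x • e := by
  have hd := h.d_pos
  rw [porismAxis, Set.pair_comm, _root_.mem_affineSpan_pair_iff_exists_lineMap_eq]
  simp only [AffineMap.lineMap_apply, h.center_outer, vsub_eq_sub, add_sub_cancel_left,
    vadd_eq_add, smul_smul]
  constructor
  · rintro ⟨x, rfl⟩
    exact ⟨x * d, add_comm _ _⟩
  · rintro ⟨x, rfl⟩
    exact ⟨x / d, by rw [div_mul_cancel₀ _ hd.ne', add_comm]⟩

theorem axisReflection_apply (h : PorismFrame Γ γ R r d e f) (x y : ℝ) :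
    axisReflection Γ γ (γ.center + x • e + y • f) = γ.center + x • e + (-y) • f := by
  have hp : γ.center + x • e ∈ affineSpan ℝ {Γ.center, γ.center} :=
    (h.mem_porismAxis_iff _).2 ⟨x, rfl⟩
  have hv : y • f ∈ (affineSpan ℝ {Γ.center, γ.center}).directionᗮ := by
    rw [direction_affineSpan, vectorSpan_pair, Submodule.mem_orthogonal_singleton_iff_inner_right]
    simp [h.center_outer, real_inner_smul_left, real_inner_smul_right, h.inner_ef]
  have := reflection_orthogonal_vadd hp hv
  rw [axisReflection, add_comm _ (y • f)]
  rw [vadd_eq_add, vadd_eq_add] at this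
  rw [this, neg_smul, add_comm]

theorem mirror_iff (h : PorismFrame Γ γ R r d e f) (δ : Circle2) (u v : ℝ) :
    δ.center = axisReflection Γ γ (porismCircle γ R r d e f u v).center ∧
      δ.radius = (porismCircle γ R r d e f u v).radius ↔ δ = porismCircle γ R r d e f u (-v) := by
  rw [Sphere.ext_iff]
  simp only [porismCircle]
  rw [h.axisReflection_apply, mul_neg, neg_mul]

/-- Symmetry means that the membership equation is invariant under `v ↦ -v`. Testing it at `(s, t)`
itself gives `s * t * (s ^ 2 - t ^ 2) = 0`. -/
theorem isAxiSymmetric_iff (h : PorismFrame Γ γ R r d e f) {ε s t : ℝ}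
    (hε : ε ^ 2 = 1) (hst : s ^ 2 + t ^ 2 = 1) :
    IsAxiSymmetric Γ γ (porismChain γ R r d e f ε s t) ↔ s * t = 0 ∨ s ^ 2 = t ^ 2 := by
  have key : IsAxiSymmetric Γ γ (porismChain γ R r d e f ε s t) ↔
      ∀ u v : ℝ, u ^ 2 + v ^ 2 = 1 → (s ^ 2 - t ^ 2) * (u * v) = s * t * (u ^ 2 - v ^ 2) →
        (s ^ 2 - t ^ 2) * (u * -v) = s * t * (u ^ 2 - (-v) ^ 2) := by
    constructor
    · intro H u v huv huv'
      have huv2 : u ^ 2 + (-v) ^ 2 = 1 := by rw [neg_sq, huv]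
      obtain ⟨i, hi⟩ := (h.porismCircle_mem_range_iff hε hst huv).2 huv'
      obtain ⟨j, hj⟩ := H i
      rw [hi, h.mirror_iff] at hj
      exact (h.porismCircle_mem_range_iff hε hst huv2).1 ⟨j, hj⟩
    · intro H i
      obtain ⟨u, v, huv, huv', hi⟩ := h.porismChain_apply hε hst i
      have huv2 : u ^ 2 + (-v) ^ 2 = 1 := by rw [neg_sq, huv]
      obtain ⟨j, hj⟩ := (h.porismCircle_mem_range_iff hε hst huv2).2 (H u v huv huv')
      refine ⟨j, ?_⟩
      rw [hi, h.mirror_iff]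
      exact hj
  rw [key]
  constructor
  · intro H
    have := H s t hst (by ring)
    have h2 : s * t * (s ^ 2 - t ^ 2) = 0 := by linear_combination -this / 2
    rcases mul_eq_zero.1 h2 with h3 | h3
    · exact Or.inl h3
    · exact Or.inr (sub_eq_zero.1 h3)
  · rintro (h0 | h0) u v huv huv'
    · rw [h0, zero_mul] at huv' ⊢
      linear_combination -huv'
    · rw [h0, sub_self, zero_mul] at huv' ⊢
      linear_combination huv'

theorem mem_porismCircle_iff (h : PorismFrame Γ γ R r d e f) {u v : ℝ}
    (huv : u ^ 2 + v ^ 2 = 1) (x : ℝ) :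
    γ.center + x • e ∈ porismCircle γ R r d e f u v ↔
      (x + r * (d + (3 * R - r) * u) / (R - r + d * u)) ^ 2 =
        (1 - 2 * v ^ 2) * (2 * R * r / (R - r + d * u)) ^ 2 := by
  have hq : √2 ^ 2 = 2 := Real.sq_sqrt (by norm_num)
  have h0 : γ.center + x • e = γ.center + x • e + (0 : ℝ) • f := by simp
  rw [mem_sphere, h0]
  refine (h.dist_eq_iff _ _ _ _ _ _).trans ?_
  rw [and_iff_left (h.radius_pos huv).le]
  simp only [porismCircle]
  rw [sub_neg_eq_add, zero_sub, neg_sq, mul_pow, mul_pow, hq]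
  constructor <;> intro H <;> linear_combination H

/-- Here `2 * v ^ 2 = 1`, so the centre is exactly one radius away from the axis and the only common
point is its foot. -/
theorem mem_porismCircle_iff_of_lateral (h : PorismFrame Γ γ R r d e f) {u v : ℝ}
    (huv : u ^ 2 + v ^ 2 = 1) (hl : u ^ 2 = v ^ 2) (x : ℝ) :
    γ.center + x • e ∈ porismCircle γ R r d e f u v ↔
      x = -(r * (d + (3 * R - r) * u) / (R - r + d * u)) := by
  have : 1 - 2 * v ^ 2 = 0 := by linear_combination -huv + hl
  rw [h.mem_porismCircle_iff huv, this, zero_mul, sq_eq_zero_iff, add_eq_zero_iff_eq_neg]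

/-- The foot of the centre is a Möbius function of `u`, whose determinant has absolute value `2 * R
* r * (R + r)` by the gauge. -/
theorem foot_injective (h : PorismFrame Γ γ R r d e f) {u v u' v' : ℝ}
    (huv : u ^ 2 + v ^ 2 = 1) (huv' : u' ^ 2 + v' ^ 2 = 1)
    (H : -(r * (d + (3 * R - r) * u) / (R - r + d * u)) =
      -(r * (d + (3 * R - r) * u') / (R - r + d * u'))) : u = u' := by
  have hc := h.curvature_pos huv
  have hc' := h.curvature_pos huv'
  have hr := h.r_pos
  have hR := hr.trans h.r_lt
  rw [neg_inj, div_eq_div_iff hc.ne' hc'.ne'] at H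
  have hk : r * (2 * R * (R + r)) * u = r * (2 * R * (R + r)) * u' := by
    linear_combination H + r * (u - u') * h.gauge
  exact mul_left_cancel₀ (by positivity) hk

theorem isLateralChain_iff (h : PorismFrame Γ γ R r d e f) {ε s t : ℝ}
    (hε : ε ^ 2 = 1) (hst : s ^ 2 + t ^ 2 = 1) :
    IsLateralChain Γ γ (porismChain γ R r d e f ε s t) ↔ s ^ 2 = t ^ 2 := by
  constructor
  · rintro ⟨-, hsym, -, htan⟩
    rcases (h.isAxiSymmetric_iff hε hst).1 hsym with h0 | h0
    · exfalso
      -- An axial chain contains the circle at `(1, 0)`, centred on the axis. The axis crosses it at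
      -- an end of a diameter and, passing through an interior point, cannot be tangent.
      have h1 : (1 : ℝ) ^ 2 + 0 ^ 2 = 1 := by norm_num
      obtain ⟨i, hi⟩ := (h.porismCircle_mem_range_iff hε hst h1).2 (by rw [h0]; ring)
      have hpos := h.radius_pos h1
      have hp : γ.center + (2 * R * r / (R - r + d * 1) -
          r * (d + (3 * R - r) * 1) / (R - r + d * 1)) • e ∈ porismCircle γ R r d e f 1 0 := by
        rw [h.mem_porismCircle_iff h1]
        ring
      have hT := htan i _ (by rw [hi]; exact hp) ((h.mem_porismAxis_iff _).2 ⟨_, rfl⟩)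
      rw [hi] at hT
      refine hT.isTangent.notMem_of_dist_lt
        (p := (porismCircle γ R r d e f 1 0).center) (by rwa [dist_self]) ?_
      rw [h.mem_porismAxis_iff]
      exact ⟨_, by simp only [porismCircle]; rw [mul_zero, zero_mul, zero_smul, add_zero]⟩
    · exact h0
  · intro h0
    have hrange := h.porismChain_range_lateral hε hst h0
    refine ⟨h.porismChain_mem hε hst, (h.isAxiSymmetric_iff hε hst).2 (Or.inr h0), ?_, ?_⟩
    · have hs : (-s) ^ 2 + (-t) ^ 2 = 1 := by rw [neg_sq, neg_sq, hst]
      have hs' : (-s) ^ 2 = (-t) ^ 2 := by rw [neg_sq, neg_sq, h0]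
      have hset : {p : Plane | p ∈ porismAxis Γ γ ∧ ∃ i, p ∈ porismChain γ R r d e f ε s t i} =
          {γ.center + (-(r * (d + (3 * R - r) * s) / (R - r + d * s))) • e,
            γ.center + (-(r * (d + (3 * R - r) * -s) / (R - r + d * -s))) • e} := by
        ext p
        constructor
        · rintro ⟨hp, i, hi⟩
          obtain ⟨x, rfl⟩ := (h.mem_porismAxis_iff p).1 hp
          obtain ⟨u, v, huv, hl, hc⟩ := hrange.le ⟨i, rfl⟩
          rw [hc, h.mem_porismCircle_iff_of_lateral huv hl] at hi
          subst hi
          have : u ^ 2 = s ^ 2 := by linarith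
          rcases sq_eq_sq_iff_eq_or_eq_neg.1 this with rfl | rfl
          · exact Or.inl rfl
          · exact Or.inr rfl
        · rintro (rfl | rfl)
          · exact ⟨(h.mem_porismAxis_iff _).2 ⟨_, rfl⟩, 0,
              (h.mem_porismCircle_iff_of_lateral hst h0 _).2 rfl⟩
          · exact ⟨(h.mem_porismAxis_iff _).2 ⟨_, rfl⟩, 2,
              (h.mem_porismCircle_iff_of_lateral hs hs' _).2 rfl⟩
      rw [hset, Set.ncard_pair]
      intro H
      have := h.foot_injective hst hs (h.coord_inj (O := γ.center) (y := 0) (y' := 0)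
        (by rw [H])).1
      nlinarith
    · intro i p hp hax
      refine ⟨hp, hax, fun q hq => ?_⟩
      obtain ⟨x, rfl⟩ := (h.mem_porismAxis_iff p).1 hax
      obtain ⟨y, rfl⟩ := (h.mem_porismAxis_iff q).1 hq
      obtain ⟨u, v, huv, hl, hc⟩ := hrange.le ⟨i, rfl⟩
      rw [hc] at hp ⊢
      rw [h.mem_porismCircle_iff_of_lateral huv hl] at hp
      rw [Sphere.mem_orthRadius_iff_inner_left, hp]
      have e1 : γ.center + y • e -ᵥ (γ.center +
          (-(r * (d + (3 * R - r) * u) / (R - r + d * u))) • e) =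
          (y + r * (d + (3 * R - r) * u) / (R - r + d * u)) • e := by
        rw [vsub_eq_sub]; module
      have e2 : γ.center + (-(r * (d + (3 * R - r) * u) / (R - r + d * u))) • e -ᵥ
          (porismCircle γ R r d e f u v).center =
          (-(√2 * v * (2 * R * r / (R - r + d * u)))) • f := by
        simp only [porismCircle]
        rw [vsub_eq_sub]; module
      rw [e1, e2, real_inner_smul_left, real_inner_smul_right, h.inner_ef, mul_zero, mul_zero]

end PorismFrame

/-! ### Rotation of chains and local extrema -/

namespace PorismFrame

variable {Γ γ : Circle2} {R r d : ℝ} {e f : Plane}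

theorem continuous_porismCircle (h : PorismFrame Γ γ R r d e f) {u v : ℝ → ℝ}
    (hu : Continuous u) (hv : Continuous v) (huv : ∀ τ, u τ ^ 2 + v τ ^ 2 = 1) :
    Continuous fun τ => porismCircle γ R r d e f (u τ) (v τ) := by
  have hne : ∀ τ, R - r + d * u τ ≠ 0 := fun τ => (h.curvature_pos (huv τ)).ne'
  rw [continuous_induced_rng]
  simp only [Function.comp_def, porismCircle]
  fun_prop (disch := assumption)

theorem continuous_porismChain (h : PorismFrame Γ γ R r d e f) {ε : ℝ} (hε : ε ^ 2 = 1)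
    {u v : ℝ → ℝ} (hu : Continuous u) (hv : Continuous v) (huv : ∀ τ, u τ ^ 2 + v τ ^ 2 = 1) :
    Continuous fun τ => porismChain γ R r d e f ε (u τ) (v τ) := by
  refine continuous_pi fun i => ?_
  fin_cases i
  · exact h.continuous_porismCircle hu hv huv
  · exact h.continuous_porismCircle (hv.const_mul ε).neg (hu.const_mul ε) fun τ => by
      linear_combination ε ^ 2 * huv τ + hε
  · exact h.continuous_porismCircle hu.neg hv.neg fun τ => by
      linear_combination huv τ
  · exact h.continuous_porismCircle (hv.const_mul ε) (hu.const_mul ε).neg fun τ => by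
      linear_combination ε ^ 2 * huv τ + hε

theorem rotation_unit {s t : ℝ} (hst : s ^ 2 + t ^ 2 = 1) (τ : ℝ) :
    (s * Real.cos τ - t * Real.sin τ) ^ 2 + (s * Real.sin τ + t * Real.cos τ) ^ 2 = 1 := by
  linear_combination (s ^ 2 + t ^ 2) * Real.sin_sq_add_cos_sq τ + hst

/-- A path of chains through the given one; along it local extremality of `L` becomes a one-variable
question. -/
theorem tendsto_rotation (h : PorismFrame Γ γ R r d e f) {ε s t : ℝ}
    (hε : ε ^ 2 = 1) (hst : s ^ 2 + t ^ 2 = 1) :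
    Filter.Tendsto (fun τ : ℝ => porismChain γ R r d e f ε (s * Real.cos τ - t * Real.sin τ)
      (s * Real.sin τ + t * Real.cos τ)) (nhds 0)
      (nhdsWithin (porismChain γ R r d e f ε s t) (poristicChains Γ γ)) := by
  refine tendsto_nhdsWithin_iff.2 ⟨?_, Filter.Eventually.of_forall fun τ =>
    h.porismChain_mem hε (rotation_unit hst τ)⟩
  have := (h.continuous_porismChain hε (u := fun τ => s * Real.cos τ - t * Real.sin τ)
    (v := fun τ => s * Real.sin τ + t * Real.cos τ) (by fun_prop) (by fun_prop)
    (rotation_unit hst)).tendsto 0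
  simpa using this

theorem hasDerivAt_rotation (s t : ℝ) :
    HasDerivAt (fun τ : ℝ => ((s * Real.cos τ - t * Real.sin τ) *
      (s * Real.sin τ + t * Real.cos τ)) ^ 2) (2 * (s * t) * (s ^ 2 - t ^ 2)) 0 := by
  have hu : HasDerivAt (fun τ : ℝ => s * Real.cos τ - t * Real.sin τ)
      (s * -Real.sin 0 - t * Real.cos 0) 0 :=
    ((Real.hasDerivAt_cos 0).const_mul s).sub ((Real.hasDerivAt_sin 0).const_mul t)
  have hv : HasDerivAt (fun τ : ℝ => s * Real.sin τ + t * Real.cos τ)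
      (s * Real.cos 0 + t * -Real.sin 0) 0 :=
    ((Real.hasDerivAt_sin 0).const_mul s).add ((Real.hasDerivAt_cos 0).const_mul t)
  refine ((hu.mul hv).pow 2).congr_deriv ?_
  simp only [Pi.mul_apply, Real.sin_zero, Real.cos_zero, Nat.cast_ofNat]
  ring

theorem exists_small_angle {p : ℝ → Prop} (hp : ∀ᶠ τ in nhds (0 : ℝ), p τ) :
    ∃ τ, p τ ∧ 0 < Real.sin τ ∧ 0 < Real.cos τ := by
  have h1 : ∀ᶠ τ in nhdsWithin (0 : ℝ) (Set.Ioi 0), p τ := hp.filter_mono nhdsWithin_le_nhds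
  have h2 : Set.Ioo (0 : ℝ) 1 ∈ nhdsWithin (0 : ℝ) (Set.Ioi 0) := Ioo_mem_nhdsGT one_pos
  obtain ⟨τ, hτ, h0, h1⟩ := (h1.and h2).exists
  have := Real.pi_gt_three
  exact ⟨τ, hτ, Real.sin_pos_of_pos_of_lt_pi h0 (by linarith),
    Real.cos_pos_of_mem_Ioo ⟨by linarith, by linarith⟩⟩

theorem isLocalMaxOn_iff (h : PorismFrame Γ γ R r d e f) {ε s t : ℝ}
    (hε : ε ^ 2 = 1) (hst : s ^ 2 + t ^ 2 = 1) :
    IsLocalMaxOn sumRadii (poristicChains Γ γ) (porismChain γ R r d e f ε s t) ↔ s * t = 0 := by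
  constructor
  · intro H
    have hev := (h.tendsto_rotation hε hst).eventually H
    simp only [h.sumRadii_le_iff hε (rotation_unit hst _) hε hst] at hev
    have hmin : IsLocalMin (fun τ : ℝ => ((s * Real.cos τ - t * Real.sin τ) *
        (s * Real.sin τ + t * Real.cos τ)) ^ 2) 0 := by
      filter_upwards [hev] with τ hτ
      simpa using hτ
    rcases mul_eq_zero.1 (hmin.hasDerivAt_eq_zero (hasDerivAt_rotation s t)) with h0 | h0
    · linarith
    -- At `s ^ 2 = t ^ 2` the derivative vanishes too, but a small rotation strictly lowers `(s * t)
    -- ^ 2` from `1/4` to `cos (2τ) ^ 2 / 4`, which raises `L`.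
    · exfalso
      obtain ⟨τ, hτ, hs, hc⟩ := exists_small_angle hev
      have e1 : (s * Real.cos τ - t * Real.sin τ) * (s * Real.sin τ + t * Real.cos τ) =
          s * t * (1 - 2 * Real.sin τ ^ 2) := by
        linear_combination Real.sin τ * Real.cos τ * h0 + s * t * Real.sin_sq_add_cos_sq τ
      have e2 : (s * t) ^ 2 = 1 / 4 := by
        linear_combination (s ^ 2 + t ^ 2 + 1) / 4 * hst - (s ^ 2 - t ^ 2) / 4 * h0
      rw [e1, mul_pow (s * t), e2] at hτ
      have e3 := Real.sin_sq_add_cos_sq τ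
      have e4 : 0 < Real.sin τ ^ 2 * Real.cos τ ^ 2 := by positivity
      have e5 : Real.cos τ ^ 2 = 1 - Real.sin τ ^ 2 := by linarith
      rw [e5] at e4
      nlinarith
  · intro h0
    refine IsMaxOn.localize fun c hc => ?_
    obtain ⟨ε', s', t', hε', hst', rfl⟩ := h.exists_eq_porismChain hc
    exact (h.sumRadii_le_iff hε' hst' hε hst).2 (by rw [h0, zero_pow two_ne_zero]; positivity)

theorem sq_mul_le_of_sq_eq {s t s' t' : ℝ} (hst : s ^ 2 + t ^ 2 = 1) (h0 : s ^ 2 = t ^ 2)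
    (hst' : s' ^ 2 + t' ^ 2 = 1) : (s' * t') ^ 2 ≤ (s * t) ^ 2 := by
  have e2 : (s * t) ^ 2 = 1 / 4 := by
    linear_combination (s ^ 2 + t ^ 2 + 1) / 4 * hst - (s ^ 2 - t ^ 2) / 4 * h0
  have e3 : (s' * t') ^ 2 = 1 / 4 - (s' ^ 2 - t' ^ 2) ^ 2 / 4 := by
    linear_combination (s' ^ 2 + t' ^ 2 + 1) / 4 * hst'
  rw [e2, e3]
  linarith [sq_nonneg (s' ^ 2 - t' ^ 2)]

theorem isLocalMinOn_iff (h : PorismFrame Γ γ R r d e f) {ε s t : ℝ}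
    (hε : ε ^ 2 = 1) (hst : s ^ 2 + t ^ 2 = 1) :
    IsLocalMinOn sumRadii (poristicChains Γ γ) (porismChain γ R r d e f ε s t) ↔
      s ^ 2 = t ^ 2 := by
  constructor
  · intro H
    have hev := (h.tendsto_rotation hε hst).eventually H
    simp only [h.sumRadii_le_iff hε hst hε (rotation_unit hst _)] at hev
    have hmax : IsLocalMax (fun τ : ℝ => ((s * Real.cos τ - t * Real.sin τ) *
        (s * Real.sin τ + t * Real.cos τ)) ^ 2) 0 := by
      filter_upwards [hev] with τ hτ
      simpa using hτ
    rcases mul_eq_zero.1 (hmax.hasDerivAt_eq_zero (hasDerivAt_rotation s t)) with h0 | h0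
    -- If `s * t = 0`, a small rotation makes the product `± sin τ * cos τ ≠ 0`, which lowers `L`.
    · exfalso
      have h0' : s * t = 0 := by linarith
      obtain ⟨τ, hτ, hs, hc⟩ := exists_small_angle hev
      have e1 : (s * Real.cos τ - t * Real.sin τ) * (s * Real.sin τ + t * Real.cos τ) =
          (s ^ 2 - t ^ 2) * (Real.sin τ * Real.cos τ) := by
        linear_combination (Real.cos τ ^ 2 - Real.sin τ ^ 2) * h0'
      have e2 : (s ^ 2 - t ^ 2) ^ 2 = 1 := by
        linear_combination (s ^ 2 + t ^ 2 + 1) * hst - 4 * (s * t) * h0'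
      rw [e1, mul_pow, e2, h0', one_mul] at hτ
      have : 0 < (Real.sin τ * Real.cos τ) ^ 2 := by positivity
      linarith
    · exact sub_eq_zero.1 h0
  · intro h0
    refine IsMinOn.localize fun c hc => ?_
    obtain ⟨ε', s', t', hε', hst', rfl⟩ := h.exists_eq_porismChain hc
    exact (h.sumRadii_le_iff hε hst hε' hst').2 (sq_mul_le_of_sq_eq hst h0 hst')

end PorismFrame

/-! ### Curvature form of the extremal values and conclusion -/

theorem mainTheorem3 (Γ γ : Circle2) (R r d A a : ℝ)
    (hR : Γ.radius = R) (hr : γ.radius = r) (hd : dist Γ.center γ.center = d)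
    (hr0 : 0 < r) (hrR : r < R) (hd0 : 0 < d)
    (hgauge : d ^ 2 = (R - r) ^ 2 - 4 * Real.tan (Real.pi / 4) ^ 2 * R * r)
    (ha : a = 1 / r) (hA : A = -(1 / R)) :
    -- the extremal values of `L`, which are attained
    IsGreatest (sumRadii '' poristicChains Γ γ) (-((A - a) ^ 2 / (A * a * (a + A)))) ∧
    IsLeast (sumRadii '' poristicChains Γ γ) (16 * (A + a) / (A - a) ^ 2) ∧
    -- they are attained exactly at the axial and at the lateral chains, respectively
    (∀ c ∈ poristicChains Γ γ,
      (sumRadii c = -((A - a) ^ 2 / (A * a * (a + A))) ↔ IsAxialChain Γ γ c) ∧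
      (sumRadii c = 16 * (A + a) / (A - a) ^ 2 ↔ IsLateralChain Γ γ c)) ∧
    -- local extrema occur at the symmetric chains only
    (∀ c ∈ poristicChains Γ γ,
      (IsLocalMaxOn sumRadii (poristicChains Γ γ) c ↔ IsAxialChain Γ γ c) ∧
      (IsLocalMinOn sumRadii (poristicChains Γ γ) c ↔ IsLateralChain Γ γ c) ∧
      (IsLocalExtrOn sumRadii (poristicChains Γ γ) c ↔ IsAxiSymmetric Γ γ c)) ∧
    -- as collections of circles, there are exactly one axial and exactly one lateral chain
    (∃! S : Set Circle2, ∃ c, IsAxialChain Γ γ c ∧ S = Set.range c) ∧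
    (∃! S : Set Circle2, ∃ c, IsLateralChain Γ γ c ∧ S = Set.range c) := by

  have hgauge' : d ^ 2 = (R - r) ^ 2 - 4 * R * r := by
    rw [hgauge, Real.tan_pi_div_four]
    ring
  obtain ⟨e, f, h⟩ := exists_porismFrame hR hr hd hr0 hrR hd0 hgauge'
  have hR0 : 0 < R := hr0.trans hrR
  have hM : 0 < R - r := sub_pos.2 hrR
  have haA : a + A = (R - r) / (R * r) := by
    rw [ha, hA]
    field_simp
    ring
  have hAa : A + a = (R - r) / (R * r) := by rw [add_comm, haA]
  have hsub : A - a = -((R + r) / (R * r)) := by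
    rw [ha, hA]
    field_simp
    ring
  have hmul : A * a = -(1 / (R * r)) := by
    rw [ha, hA]
    field_simp
  have hmax : -((A - a) ^ 2 / (A * a * (a + A))) = (R + r) ^ 2 / (R - r) := by
    rw [hsub, hmul, haA]
    field_simp
  have hmin : 16 * (A + a) / (A - a) ^ 2 = 16 * R * r * (R - r) / (R + r) ^ 2 := by
    rw [hAa, hsub]
    field_simp
  have h1 : (1 : ℝ) ^ 2 = 1 := one_pow 2
  have h10 : (1 : ℝ) ^ 2 + 0 ^ 2 = 1 := by norm_num
  -- The point `(√(1/2), √(1/2))` represents the lateral chain, as `(1, 0)` does the axial one.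
  have hk : √(1 / 2) ^ 2 + √(1 / 2) ^ 2 = 1 := by
    rw [Real.sq_sqrt (by norm_num)]
    norm_num
  rw [hmax, hmin]
  refine ⟨⟨⟨_, h.porismChain_mem h1 h10, (h.sumRadii_eq_max_iff h1 h10).2 (mul_zero _)⟩, ?_⟩,
    ⟨⟨_, h.porismChain_mem h1 hk, (h.sumRadii_eq_min_iff h1 hk).2 rfl⟩, ?_⟩, ?_, ?_, ?_, ?_⟩
  · rintro _ ⟨c, hc, rfl⟩
    obtain ⟨ε, s, t, hε, hst, rfl⟩ := h.exists_eq_porismChain hc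
    rw [← (h.sumRadii_eq_max_iff h1 h10).2 (mul_zero _), h.sumRadii_le_iff hε hst h1 h10,
      mul_zero, zero_pow two_ne_zero]
    positivity
  · rintro _ ⟨c, hc, rfl⟩
    obtain ⟨ε, s, t, hε, hst, rfl⟩ := h.exists_eq_porismChain hc
    rw [← (h.sumRadii_eq_min_iff h1 hk).2 rfl, h.sumRadii_le_iff h1 hk hε hst]
    exact PorismFrame.sq_mul_le_of_sq_eq hk rfl hst
  · intro c hc
    obtain ⟨ε, s, t, hε, hst, rfl⟩ := h.exists_eq_porismChain hc
    rw [h.isAxialChain_iff hε hst, h.isLateralChain_iff hε hst]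
    exact ⟨h.sumRadii_eq_max_iff hε hst, h.sumRadii_eq_min_iff hε hst⟩
  · intro c hc
    obtain ⟨ε, s, t, hε, hst, rfl⟩ := h.exists_eq_porismChain hc
    rw [h.isAxialChain_iff hε hst, h.isLateralChain_iff hε hst, h.isAxiSymmetric_iff hε hst,
      ← h.isLocalMaxOn_iff hε hst, ← h.isLocalMinOn_iff hε hst]
    exact ⟨Iff.rfl, Iff.rfl, or_comm⟩
  · refine ⟨_, ⟨_, (h.isAxialChain_iff h1 h10).2 (mul_zero _), rfl⟩, ?_⟩
    rintro _ ⟨c, hc, rfl⟩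
    obtain ⟨ε, s, t, hε, hst, rfl⟩ := h.exists_eq_porismChain hc.1
    rw [h.porismChain_range_axial hε hst ((h.isAxialChain_iff hε hst).1 hc),
      h.porismChain_range_axial h1 h10 (mul_zero _)]
  · refine ⟨_, ⟨_, (h.isLateralChain_iff h1 hk).2 rfl, rfl⟩, ?_⟩
    rintro _ ⟨c, hc, rfl⟩
    obtain ⟨ε, s, t, hε, hst, rfl⟩ := h.exists_eq_porismChain hc.1
    rw [h.porismChain_range_lateral hε hst ((h.isLateralChain_iff hε hst).1 hc),
      h.porismChain_range_lateral h1 hk rfl]
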